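/- Let $(W,S)$ be a Coxeter system with $W$ finite and length function $l$, let $\Gamma$ be an abelian group with a total order $\le$ such that $g\le g'$ implies $g+h\le g'+h$, and let $L\colon W\to\Gamma$ satisfy $L(ww')=L(w)+L(w')$ whenever $l(ww')=l(w)+l(w')$, and $L(s)>0$ for all $s\in S$. Let $R\subseteq\mathbb C$ be a subring containing $2\cos(2\pi/m_{st})$ for all $s,t\in S$, where $m_{st}$ is the order of $st$; let $F$ be the field of fractions of $R$, let $A=R[\Gamma]$ with $R$-basis $\{\varepsilon^g\mid g\in\Gamma\}$, and let $K$ be the field of fractions of $A$. Let $\mathbf H$ be the generic Iwahori–Hecke algebra over $A$: it has an $A$-basis $\{T_w\mid w\in W\}$, $T_1$ is its identity element, and $T_sT_w=T_{sw}$ if $l(sw)>l(w)$, $T_sT_w=T_{sw}+(\varepsilon^{L(s)}-\varepsilon^{-L(s)})T_w$ if $l(sw)<l(w)$. Put $\mathbf H_K=K\otimes_A\mathbf H$ and let $\{E^\lambda_\varepsilon\mid\lambda\in\Lambda\}$ be a complete set of representatives of the isomorphism classes of simple $\mathbf H_K$-modules, $d_\lambda=\dim_K E^\lambda_\varepsilon$.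 Let $\mathbf c_\lambda\in K$ be given by $$\sum_{w\in W}\operatorname{trace}(T_w,E^\lambda_\varepsilon)\operatorname{trace}(T_{w^{-1}},E^\lambda_\varepsilon)=d_\lambda\mathbf c_\lambda,$$ and define $\mathbf a_\lambda\in\Gamma$ and $0\ne f_\lambda\in F$ by the condition that $\mathbf c_\lambda=f_\lambda\varepsilon^{-2\mathbf a_\lambda}+{}$ an $F$-linear combination of terms $\varepsilon^g$ with $g>-2\mathbf a_\lambda$. Let $F[\Gamma_{>0}]$ be the set of $F$-linear combinations of the $\varepsilon^g$ with $g>0$. Every $0\neq x\in K$ can be written as $x=r_x\varepsilon^{g_x}(1+p)/(1+q)$ with unique $0\ne r_x\in F$ and $g_x\in\Gamma$, and some $p,q\in F[\Gamma_{>0}]$. Put $\mathcal O=\{0\}\cup\{x\in K\mid x\ne0,\ g_x\ge0\}$ and $\mathfrak p=\{0\}\cup\{x\in K\mid x\ne 0,\ g_x>0\}$; the constant term of $x\in\mathcal O$ is the unique $r\in F$ with $x-r\in\mathfrak p$. A matrix representation $\rho^\lambda\colon\mathbf H_K\to M_{d_\lambda}(K)$ afforded by $E^\lambda_\varepsilon$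 with respect to some $K$-basis is called balanced if $\varepsilon^{\mathbf a_\lambda}\rho^\lambda_{ij}(T_w)\in\mathcal O$ for all $w,i,j$; then $c^{ij}_{w,\lambda}\in F$ denotes the constant term of $(-1)^{l(w)}\varepsilon^{\mathbf a_\lambda}\rho^\lambda_{ij}(T_w)$. Given a family $\rho=(\rho^\lambda)_{\lambda\in\Lambda}$ of balanced representations, $\rho^\lambda$ being afforded by $E^\lambda_\varepsilon$, put $$\tilde\gamma_{x,y,z}=\sum_{\lambda\in\Lambda}\sum_{1\le i,j,k\le d_\lambda}f_\lambda^{-1}c^{ij}_{x,\lambda}c^{jk}_{y,\lambda}c^{ki}_{z,\lambda},\qquad \tilde n_w=\sum_{\lambda\in\Lambda}\sum_{1\le i\le d_\lambda}f_\lambda^{-1}c^{ii}_{w^{-1},\lambda},$$ and let $\tilde{\mathbf J}$ be the $F$-vector space with basis $\{t_w\mid w\in W\}$, the bilinear product $t_xt_y=\sum_{z\in W}\tilde\gamma_{x,y,z^{-1}}t_z$ and the distinguished element (the identity) $1_{\tilde{\mathbf J}}=\sum_{w:\,\tilde n_w\ne0}\tilde n_wt_w$. **Proposition.** Let $\rho=(\rho^\lambda)_{\lambda\in\Lambda}$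 and $\sigma=(\sigma^\lambda)_{\lambda\in\Lambda}$ be two such families of balanced representations, $\rho^\lambda$ and $\sigma^\lambda$ both being afforded by $E^\lambda_\varepsilon$. Then the structure constants $\tilde\gamma_{x,y,z}$ ($x,y,z\in W$) and the elements $\tilde n_w$ ($w\in W$) are the same for $\rho$ and for $\sigma$. Consequently the ring $\tilde{\mathbf J}$ (its product and its identity element) does not depend on the choice of the balanced representations. -/

import Mathlib

open scoped TensorProduct

/-! ### Weight functions -/

namespace CoxeterSystem

variable {B W : Type*} [Group W] {M : CoxeterMatrix B} (cs : CoxeterSystem M W)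

/-- A weight function on a Coxeter group with values in an additive group. -/
structure WeightFunction (Γ : Type*) [Add Γ] where
  toFun : W → Γ
  map_mul' : ∀ w w' : W, cs.length (w * w') = cs.length w + cs.length w' →
    toFun (w * w') = toFun w + toFun w'

instance (Γ : Type*) [Add Γ] : CoeFun (cs.WeightFunction Γ) (fun _ => W → Γ) :=
  ⟨WeightFunction.toFun⟩

/-! ### The exchange condition

It is needed to see that the operators below define an algebra with a basis indexed by `W`. -/

open Classical in
/-- One step of the action of `W` on `W × ℤ/2` that counts inversions modulo two. -/
noncomputable def invStep (i : B) : Function.End (W × ZMod 2) := fun p =>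
  (cs.simple i * p.1 * cs.simple i, p.2 + if p.1 = cs.simple i then 1 else 0)

open Classical in
theorem prod_invStep (ω : List B) (t : W) (e : ZMod 2) :
    (ω.map cs.invStep).prod (t, e) =
      (cs.wordProd ω * t * (cs.wordProd ω)⁻¹, e + (cs.rightInvSeq ω).count t) := by
  induction ω with
  | nil => simp [Function.End.one_def]
  | cons i ω ih =>
    rw [List.map_cons, List.prod_cons]
    change cs.invStep i ((ω.map cs.invStep).prod (t, e)) = _
    rw [ih]
    simp only [invStep, CoxeterSystem.rightInvSeq, cs.wordProd_cons, List.count_cons]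
    have h : (cs.wordProd ω * t * (cs.wordProd ω)⁻¹ = cs.simple i) ↔
        ((cs.wordProd ω)⁻¹ * cs.simple i * cs.wordProd ω = t) := by
      constructor
      · intro h; rw [← h]; group
      · intro h; rw [← h]; group
    refine Prod.ext ?_ ?_
    · simp [mul_assoc]
    · by_cases h' : (cs.wordProd ω)⁻¹ * cs.simple i * cs.wordProd ω = t
      · simp only [if_pos (h.2 h'), beq_iff_eq, if_pos h']
        push_cast; ring
      · simp only [if_neg (fun hh => h' (h.1 hh)), beq_iff_eq, if_neg h']
        push_cast; ring

theorem prod_reverse_alternatingWord {G : Type*} [Monoid G] (f : B → G) (i j : B) (m : ℕ) :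
    ((alternatingWord i j (2 * m)).reverse.map f).prod = (f j * f i) ^ m := by
  induction m with
  | zero => simp [alternatingWord]
  | succ m ih =>
    have : alternatingWord i j (2 * (m + 1)) = alternatingWord i j (2 * m) ++ [i, j] := by
      rw [show 2 * (m + 1) = 2 * m + 1 + 1 by ring, alternatingWord_succ, alternatingWord_succ]
      simp
    rw [this, pow_succ', ← ih]
    simp [mul_assoc]

open Classical in
theorem count_leftInvSeq_alternatingWord (i j : B) (t : W) :
    (((cs.leftInvSeq (alternatingWord j i (2 * M i j))).count t : ℕ) : ZMod 2) = 0 := by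
  set m := M i j with hm
  set f : ℕ → W := fun k => cs.simple j * (cs.simple i * cs.simple j) ^ k with hf
  have h1 : cs.leftInvSeq (alternatingWord j i (2 * m)) = (List.range (2 * m)).map f := by
    apply List.ext_getElem
    · simp
    · intro k hk _
      have hk' : k < 2 * m := by simpa using hk
      rw [cs.getElem_leftInvSeq_alternatingWord j i m k hk',
        cs.prod_alternatingWord_eq_mul_pow]
      have h2 : ¬ Even (2 * k + 1) := by simp
      have h3 : (2 * k + 1) / 2 = k := by omega
      simp [h2, h3, hf]
  have h2 : (List.range (2 * m)).map f = (List.range m).map f ++ (List.range m).map f := by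
    rw [two_mul, List.range_add, List.map_append, List.map_map]
    congr 1
    apply List.map_congr_left
    intro k _
    simp [hf, pow_add, hm]
  rw [h1, h2, List.count_append, Nat.cast_add]
  exact CharTwo.add_self_eq_zero _

theorem isLiftable_invStep : M.IsLiftable cs.invStep := by
  classical
  intro i j
  rw [← prod_reverse_alternatingWord]
  funext p
  obtain ⟨t, e⟩ := p
  have h : cs.wordProd (alternatingWord j i (2 * M i j)).reverse = 1 := by
    rw [wordProd, prod_reverse_alternatingWord, cs.simple_mul_simple_pow]
  rw [prod_invStep, h, cs.rightInvSeq_reverse, List.count_reverse,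
    count_leftInvSeq_alternatingWord]
  simp [Function.End.one_def]

open Classical in
/-- The parity of the number of occurrences of `t` in a right inversion sequence depends only on
the group element. -/
theorem count_rightInvSeq_congr {ω ω' : List B} (h : cs.wordProd ω = cs.wordProd ω') (t : W) :
    (((cs.rightInvSeq ω).count t : ℕ) : ZMod 2) = (cs.rightInvSeq ω').count t := by
  have key : ∀ ω : List B, (ω.map cs.invStep).prod =
      cs.lift ⟨cs.invStep, cs.isLiftable_invStep⟩ (cs.wordProd ω) := by
    intro ω
    rw [wordProd, map_list_prod, List.map_map]
    congr 1
    apply List.map_congr_left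
    intro i _
    simp
  have h1 := congrFun ((key ω).trans ((congrArg _ h).trans (key ω').symm)) (t, 0)
  rw [prod_invStep, prod_invStep] at h1
  simpa using congrArg Prod.snd h1

theorem mem_rightInvSeq_of_isRightDescent {ω : List B} {i : B}
    (h : cs.IsRightDescent (cs.wordProd ω) i) : cs.simple i ∈ cs.rightInvSeq ω := by
  classical
  obtain ⟨ω', hω', hw⟩ := cs.exists_isReduced (cs.wordProd ω * cs.simple i)
  have hn : cs.simple i ∉ cs.rightInvSeq ω' := by
    intro hmem
    have := (cs.isRightInversion_of_mem_rightInvSeq hω' hmem).2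
    rw [← hw] at this
    rw [IsRightDescent] at h
    simp at this
    omega
  have h1 : cs.wordProd ω = cs.wordProd (ω'.concat i) := by
    rw [wordProd_concat, ← hw]; simp
  have h2 := cs.count_rightInvSeq_congr h1 (cs.simple i)
  have h3 : (List.map (MulAut.conj (cs.simple i)) (cs.rightInvSeq ω')).count (cs.simple i) = 0 := by
    rw [List.count_eq_zero]
    intro hmem
    obtain ⟨u, hu, hu'⟩ := List.mem_map.1 hmem
    apply hn
    have : u = cs.simple i := by
      rw [MulAut.conj_apply, mul_inv_eq_iff_eq_mul] at hu'
      exact mul_left_cancel hu'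
    rwa [← this]
  rw [rightInvSeq_concat, List.concat_eq_append, List.count_append, h3] at h2
  simp at h2
  by_contra hcon
  rw [List.count_eq_zero.2 hcon] at h2
  simp at h2

/-- If `s w > w`, `w t > w` and `s w t < s w`, then `s w = w t`. -/
theorem simple_mul_eq_mul_simple {w : W} {i j : B}
    (hi : cs.length w < cs.length (cs.simple i * w))
    (hj : cs.length w < cs.length (w * cs.simple j))
    (hij : cs.length (cs.simple i * w * cs.simple j) < cs.length (cs.simple i * w)) :
    cs.simple i * w = w * cs.simple j := by
  obtain ⟨ω, hω, rfl⟩ := cs.exists_isReduced w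
  have h : cs.simple j ∈ cs.rightInvSeq (i :: ω) :=
    cs.mem_rightInvSeq_of_isRightDescent (by rwa [IsRightDescent, wordProd_cons])
  rw [rightInvSeq, List.mem_cons] at h
  rcases h with h | h
  · rw [h]; group
  · exact absurd (cs.isRightInversion_of_mem_rightInvSeq hω h).2 (by omega)

/-! ### The Iwahori–Hecke algebra

Over a commutative ring `k` with parameters `q i`, it is the algebra with basis `T w` (`w ∈ W`),
with `T 1 = 1`, and `T s * T w = T (s w)` if `l (s w) > l w` and
`T s * T w = T (s w) + q s • T w` if `l (s w) < l w`.  It is realised as an algebra of operators on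
the free module on `W`, namely the one generated by the operators of multiplication by `T s` from
the left. -/

section Hecke

variable {k : Type*} [CommRing k] (q : B → k)

open Classical in
/-- The operator of left multiplication by `T s` on the free module on `W`. -/
noncomputable def leftOp (i : B) : Module.End k (W →₀ k) :=
  Finsupp.linearCombination k fun w =>
    Finsupp.single (cs.simple i * w) 1 +
      if cs.length (cs.simple i * w) < cs.length w then q i • Finsupp.single w 1 else 0

open Classical in
/-- The operator of right multiplication by `T s` on the free module on `W`. -/
noncomputable def rightOp (i : B) : Module.End k (W →₀ k) :=
  Finsupp.linearCombination k fun w =>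
    Finsupp.single (w * cs.simple i) 1 +
      if cs.length (w * cs.simple i) < cs.length w then q i • Finsupp.single w 1 else 0

open Classical in
theorem leftOp_single (i : B) (w : W) : cs.leftOp q i (Finsupp.single w 1) =
    Finsupp.single (cs.simple i * w) 1 +
      if cs.length (cs.simple i * w) < cs.length w then q i • Finsupp.single w 1 else 0 := by
  simp [leftOp]

open Classical in
theorem rightOp_single (i : B) (w : W) : cs.rightOp q i (Finsupp.single w 1) =
    Finsupp.single (w * cs.simple i) 1 +
      if cs.length (w * cs.simple i) < cs.length w then q i • Finsupp.single w 1 else 0 := by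
  simp [rightOp]

/-- The parameters are constant on conjugacy classes of simple reflections. -/
def IsClassFunction : Prop :=
  ∀ (i j : B) (w : W), cs.simple i * w = w * cs.simple j → q i = q j

theorem leftOp_rightOp (hq : cs.IsClassFunction q) (i j : B) (x : W →₀ k) :
    cs.leftOp q i (cs.rightOp q j x) = cs.rightOp q j (cs.leftOp q i x) := by
  classical
  rw [← LinearMap.comp_apply, ← LinearMap.comp_apply]
  congr 1
  apply Finsupp.lhom_ext'
  intro w
  ext1
  simp only [LinearMap.comp_apply, Finsupp.lsingle_apply, leftOp_single, rightOp_single, map_add,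
    apply_ite, map_smul, map_zero, mul_assoc]
  have ha := cs.length_simple_mul w i
  have hb := cs.length_mul_simple w j
  have hc := cs.length_simple_mul (w * cs.simple j) i
  have hd := cs.length_mul_simple (cs.simple i * w) j
  rw [mul_assoc] at hd
  have hE1 : cs.length w < cs.length (cs.simple i * w) →
      cs.length w < cs.length (w * cs.simple j) →
      cs.length (cs.simple i * (w * cs.simple j)) < cs.length (cs.simple i * w) →
      cs.simple i * w = w * cs.simple j := by
    intro h1 h2 h3
    exact cs.simple_mul_eq_mul_simple h1 h2 (by rwa [mul_assoc])
  have hE2 : cs.length (cs.simple i * w) < cs.length w →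
      cs.length (cs.simple i * w) < cs.length (cs.simple i * (w * cs.simple j)) →
      cs.length (w * cs.simple j) < cs.length w →
      cs.simple i * w = w * cs.simple j := by
    intro h1 h2 h3
    have := cs.simple_mul_eq_mul_simple (w := cs.simple i * w) (i := i) (j := j)
      (by simpa using h1) (by rwa [mul_assoc]) (by simpa using h3)
    rw [cs.simple_mul_simple_cancel_left] at this
    conv_rhs => rw [this]
    simp
  by_cases h1 : cs.length (cs.simple i * w) < cs.length w <;>
  by_cases h2 : cs.length (w * cs.simple j) < cs.length w <;>
  by_cases h3 : cs.length (cs.simple i * (w * cs.simple j)) < cs.length (w * cs.simple j) <;>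
  by_cases h4 : cs.length (cs.simple i * (w * cs.simple j)) < cs.length (cs.simple i * w) <;>
  simp only [h1, h2, h3, h4, if_true, if_false] <;>
  try (exfalso; omega)
  · module
  · have e := hE2 (by omega) (by omega) (by omega)
    rw [e, hq i j w e]
  · module
  · module
  · have e := hE1 (by omega) (by omega) (by omega)
    rw [e, hq i j w e]

/-- The Iwahori–Hecke algebra with parameters `q`. -/
noncomputable def heckeAlgebra : Subalgebra k (Module.End k (W →₀ k)) :=
  Algebra.adjoin k (Set.range (cs.leftOp q))

noncomputable instance : Ring (cs.heckeAlgebra q) := Algebra.semiringToRing k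

/-- Evaluation at the basis vector of the identity. -/
noncomputable def heckeEval : cs.heckeAlgebra q →ₗ[k] (W →₀ k) :=
  (LinearMap.applyₗ (Finsupp.single (1 : W) (1 : k))).comp (cs.heckeAlgebra q).val.toLinearMap

theorem heckeEval_apply (h : cs.heckeAlgebra q) :
    cs.heckeEval q h = (h : Module.End k (W →₀ k)) (Finsupp.single 1 1) := rfl

/-- The generator of the Iwahori–Hecke algebra that corresponds to a simple reflection. -/
noncomputable def heckeGen (i : B) : cs.heckeAlgebra q :=
  ⟨cs.leftOp q i, Algebra.subset_adjoin ⟨i, rfl⟩⟩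

theorem heckeEval_gen_mul (i : B) (h : cs.heckeAlgebra q) :
    cs.heckeEval q (cs.heckeGen q i * h) = cs.leftOp q i (cs.heckeEval q h) := rfl

theorem heckeEval_surjective : Function.Surjective (cs.heckeEval q) := by
  classical
  rw [← LinearMap.range_eq_top, eq_top_iff, ← Finsupp.basisSingleOne.span_eq,
    Submodule.span_le]
  rintro _ ⟨w, rfl⟩
  rw [Finsupp.coe_basisSingleOne]
  induction hn : cs.length w using Nat.strong_induction_on generalizing w with
  | _ n ih =>
    by_cases hw : w = 1
    · exact ⟨1, by rw [hw]; rfl⟩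
    · obtain ⟨i, hi⟩ := cs.exists_leftDescent_of_ne_one hw
      rw [IsLeftDescent] at hi
      obtain ⟨h, hh⟩ := ih _ (hn ▸ hi) (cs.simple i * w) rfl
      refine ⟨cs.heckeGen q i * h, ?_⟩
      rw [heckeEval_gen_mul, hh, leftOp_single, cs.simple_mul_simple_cancel_left,
        if_neg (by omega), add_zero]

theorem rightOp_commute (hq : cs.IsClassFunction q) (h : cs.heckeAlgebra q) (j : B)
    (x : W →₀ k) : (h : Module.End k (W →₀ k)) (cs.rightOp q j x) =
      cs.rightOp q j ((h : Module.End k (W →₀ k)) x) := by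
  obtain ⟨h, hh⟩ := h
  change h _ = cs.rightOp q j (h x)
  induction hh using Algebra.adjoin_induction generalizing x with
  | mem y hy => obtain ⟨i, rfl⟩ := hy; exact cs.leftOp_rightOp q hq i j x
  | algebraMap r => simp [Module.algebraMap_end_apply]
  | add a b _ _ ha hb => simp [ha, hb]
  | mul a b _ _ ha hb => simp [ha, hb]

theorem heckeEval_injective (hq : cs.IsClassFunction q) :
    Function.Injective (cs.heckeEval q) := by
  classical
  rw [← LinearMap.ker_eq_bot, LinearMap.ker_eq_bot']
  intro h h0
  apply Subtype.ext
  refine Finsupp.lhom_ext' fun w => LinearMap.ext_ring ?_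
  change (h : Module.End k (W →₀ k)) (Finsupp.single w 1) = 0
  induction hn : cs.length w using Nat.strong_induction_on generalizing w with
  | _ n ih =>
    by_cases hw : w = 1
    · rw [hw]; exact h0
    · obtain ⟨i, hi⟩ := cs.exists_rightDescent_of_ne_one hw
      rw [IsRightDescent] at hi
      have h1 := ih _ (hn ▸ hi) (w * cs.simple i) rfl
      have h2 : Finsupp.single w (1 : k) =
          cs.rightOp q i (Finsupp.single (w * cs.simple i) 1) := by
        rw [rightOp_single, cs.simple_mul_simple_cancel_right, if_neg (by omega), add_zero]
      rw [h2, rightOp_commute _ _ hq, h1, map_zero]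

/-- The standard basis of the Iwahori–Hecke algebra. -/
noncomputable def heckeBasis (hq : cs.IsClassFunction q) :
    Module.Basis W k (cs.heckeAlgebra q) :=
  Module.Basis.ofRepr (LinearEquiv.ofBijective (cs.heckeEval q)
    ⟨cs.heckeEval_injective q hq, cs.heckeEval_surjective q⟩)

theorem heckeEval_basis (hq : cs.IsClassFunction q) (w : W) :
    cs.heckeEval q (cs.heckeBasis q hq w) = Finsupp.single w 1 :=
  (cs.heckeBasis q hq).repr_self w

theorem heckeBasis_one (hq : cs.IsClassFunction q) : cs.heckeBasis q hq 1 = 1 := by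
  apply cs.heckeEval_injective q hq
  rw [heckeEval_basis]; rfl

theorem heckeBasis_simple (hq : cs.IsClassFunction q) (i : B) :
    cs.heckeBasis q hq (cs.simple i) = cs.heckeGen q i := by
  apply cs.heckeEval_injective q hq
  rw [heckeEval_basis, ← mul_one (cs.heckeGen q i), ← cs.heckeBasis_one q hq, heckeEval_gen_mul,
    heckeEval_basis, leftOp_single]
  simp

open Classical in
/-- The multiplication rule of the Iwahori–Hecke algebra. -/
theorem heckeBasis_simple_mul (hq : cs.IsClassFunction q) (i : B) (w : W) :
    cs.heckeBasis q hq (cs.simple i) * cs.heckeBasis q hq w =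
      if cs.length w < cs.length (cs.simple i * w) then cs.heckeBasis q hq (cs.simple i * w)
      else cs.heckeBasis q hq (cs.simple i * w) + q i • cs.heckeBasis q hq w := by
  have := cs.length_simple_mul w i
  apply cs.heckeEval_injective q hq
  rw [heckeBasis_simple, heckeEval_gen_mul, heckeEval_basis, leftOp_single]
  split_ifs
  · omega
  · simp [heckeEval_basis]
  · simp [heckeEval_basis]
  · omega

end Hecke

/-- A weight function takes the same value on conjugate simple reflections. -/
theorem WeightFunction.apply_simple_eq {Γ : Type*} [AddCommGroup Γ] (L : cs.WeightFunction Γ)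
    (i j : B) (w : W) (h : cs.simple i * w = w * cs.simple j) :
    L (cs.simple i) = L (cs.simple j) := by
  have key : ∀ w : W, cs.simple i * w = w * cs.simple j →
      cs.length w < cs.length (cs.simple i * w) → L (cs.simple i) = L (cs.simple j) := by
    intro w h hlt
    have hl := cs.length_simple_mul w i
    have h1 := L.map_mul' (cs.simple i) w (by rw [cs.length_simple]; omega)
    have h2 := L.map_mul' w (cs.simple j) (by rw [← h, cs.length_simple]; omega)
    rw [h, h2, add_comm] at h1
    exact (add_right_cancel h1).symm
  rcases cs.length_simple_mul w i with hl | hl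
  · exact key w h (by omega)
  · refine key (cs.simple i * w) ?_ ?_
    · rw [cs.simple_mul_simple_cancel_left, h, cs.simple_mul_simple_cancel_right]
    · rw [cs.simple_mul_simple_cancel_left]; omega

end CoxeterSystem

/-! ### Leading matrix coefficients -/

namespace LeadingCoefficients

/-- The field of fractions `F` of `R`. -/
abbrev ScalarField (R : Subring ℂ) : Type := FractionRing R

/-- The group ring `A = R[Γ]`. -/
abbrev LaurentRing (R : Subring ℂ) (Γ : Type*) := AddMonoidAlgebra R Γ

section Parameters

variable {B W : Type*} [Group W] {M : CoxeterMatrix B} {cs : CoxeterSystem M W}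
  (R : Subring ℂ) {Γ : Type*} [AddCommGroup Γ] (L : cs.WeightFunction Γ)

/-- The parameters `v_s - v_s⁻¹`, where `v_s = ε ^ (L s)`. -/
noncomputable def parameter (i : B) : LaurentRing R Γ :=
  AddMonoidAlgebra.single (L (cs.simple i)) 1 - AddMonoidAlgebra.single (-L (cs.simple i)) 1

theorem isClassFunction_parameter : cs.IsClassFunction (parameter R L) := by
  intro i j w h
  rw [parameter, parameter, CoxeterSystem.WeightFunction.apply_simple_eq cs L i j w h]

end Parameters

section Valuation

variable (R : Subring ℂ) {Γ : Type*} [AddCommGroup Γ] [LinearOrder Γ] [IsOrderedAddMonoid Γ]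

variable (Γ) in
/-- The field of fractions `K` of `A = R[Γ]`. -/
abbrev LaurentField := FractionRing (LaurentRing R Γ)

noncomputable instance : Algebra (ScalarField R) (LaurentField R Γ) :=
  FractionRing.liftAlgebra R (LaurentField R Γ)

/-- The element `ε ^ g` of `K`. -/
noncomputable def eps (g : Γ) : LaurentField R Γ :=
  algebraMap (LaurentRing R Γ) (LaurentField R Γ) (AddMonoidAlgebra.single g 1)

/-- The set of `F`-linear combinations of the `ε ^ g` with `g > c`. -/
noncomputable def combinationsAbove (c : Γ) : Submodule (ScalarField R) (LaurentField R Γ) :=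
  Submodule.span (ScalarField R) (eps R '' Set.Ioi c)

/-- `x = r ε ^ g (1 + p) / (1 + q)` with `p` and `q` in `F[Γ_{>0}]`. -/
def HasExpansion (x : LaurentField R Γ) (r : ScalarField R) (g : Γ) : Prop :=
  ∃ p ∈ combinationsAbove R (0 : Γ), ∃ q ∈ combinationsAbove R (0 : Γ),
    x = algebraMap (ScalarField R) (LaurentField R Γ) r * eps R g * ((1 + p) / (1 + q))

variable (Γ) in
/-- The valuation ring `𝒪` of `K` (`x = 0` is the case `r = 0`). -/
def integers : Set (LaurentField R Γ) :=
  {x | ∃ (r : ScalarField R) (g : Γ), 0 ≤ g ∧ HasExpansion R x r g}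

variable (Γ) in
/-- The maximal ideal `𝔭` of `𝒪`. -/
def maximalIdeal : Set (LaurentField R Γ) :=
  {x | x = 0 ∨ ∃ (r : ScalarField R) (g : Γ), 0 < g ∧ HasExpansion R x r g}

open Classical in
/-- The constant term of `x ∈ 𝒪`: the unique `r ∈ F` with `x - r ∈ 𝔭`. -/
noncomputable def constantTerm (x : LaurentField R Γ) : ScalarField R :=
  if h : ∃ r : ScalarField R,
      x - algebraMap (ScalarField R) (LaurentField R Γ) r ∈ maximalIdeal R Γ
  then h.choose else 0

end Valuation

section Representations

universe u v w

variable {B : Type*} {W : Type u} [Group W] {M : CoxeterMatrix B} {cs : CoxeterSystem M W}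
  (R : Subring ℂ) {Γ : Type v} [AddCommGroup Γ] [LinearOrder Γ] [IsOrderedAddMonoid Γ]
  (L : cs.WeightFunction Γ)

/-- The generic Iwahori–Hecke algebra over `A`. -/
noncomputable abbrev GenericHecke := cs.heckeAlgebra (parameter R L)

/-- The generic Iwahori–Hecke algebra with scalars extended to `K`. -/
abbrev HeckeK := LaurentField R Γ ⊗[LaurentRing R Γ] GenericHecke R L

/-- The basis element `T w` of the Iwahori–Hecke algebra over `K`. -/
noncomputable def T (w : W) : HeckeK R L :=
  1 ⊗ₜ[LaurentRing R Γ] cs.heckeBasis (parameter R L) (isClassFunction_parameter R L) w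

/-- `E` is a complete set of representatives of the isomorphism classes of simple modules of the
Iwahori–Hecke algebra over `K`. -/
structure IsIrr {Λ : Type*} (E : Λ → Type w) [∀ l, AddCommGroup (E l)]
    [∀ l, Module (HeckeK R L) (E l)] : Prop where
  simple : ∀ l, IsSimpleModule (HeckeK R L) (E l)
  injective : ∀ l m, Nonempty (E l ≃ₗ[HeckeK R L] E m) → l = m
  exhaustive : ∀ (V : Type (max u v)) [AddCommGroup V] [Module (HeckeK R L) V],
    IsSimpleModule (HeckeK R L) V → ∃ l, Nonempty (V ≃ₗ[HeckeK R L] E l)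

section Single

variable (E : Type w) [AddCommGroup E] [Module (LaurentField R Γ) E] [Module (HeckeK R L) E]
  [IsScalarTower (LaurentField R Γ) (HeckeK R L) E]

/-- The action of an element of the Iwahori–Hecke algebra on a module. -/
noncomputable def action (h : HeckeK R L) : E →ₗ[LaurentField R Γ] E :=
  Algebra.lsmul (LaurentField R Γ) (LaurentField R Γ) E h

/-- The dimension over `K` of a module. -/
noncomputable def dim : ℕ := Module.finrank (LaurentField R Γ) E

/-- The element `𝒄` of `K` determined by `∑ w, trace (T w) * trace (T w⁻¹) = dim * 𝒄`. -/
noncomputable def schurElement [Fintype W] : LaurentField R Γ :=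
  (∑ w : W, LinearMap.trace _ _ (action R L E (T R L w)) *
    LinearMap.trace _ _ (action R L E (T R L w⁻¹))) / (dim R (Γ := Γ) E : LaurentField R Γ)

/-- `𝒄 = f ε ^ (-2 a) +` a combination of terms `ε ^ g` with `g > -2 a`, where `f ≠ 0`. -/
def IsLeadingData [Fintype W] (d : Γ × ScalarField R) : Prop :=
  d.2 ≠ 0 ∧ schurElement R L E -
    algebraMap (ScalarField R) (LaurentField R Γ) d.2 * eps R (-(2 • d.1)) ∈
      combinationsAbove R (-(2 • d.1))

open Classical in
/-- The pair `(𝒂, f)` that is determined by the element `𝒄`. -/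
noncomputable def leadingData [Fintype W] : Γ × ScalarField R :=
  if h : ∃ d, IsLeadingData R L E d then h.choose else (0, 0)

/-- The invariant `𝒂`. -/
noncomputable def aInvariant [Fintype W] : Γ := (leadingData R L E).1

/-- The invariant `f`. -/
noncomputable def fInvariant [Fintype W] : ScalarField R := (leadingData R L E).2

/-- Matrix representations over `K` of the degree of `E`. -/
abbrev MatrixRep :=
  HeckeK R L →ₐ[LaurentField R Γ]
    Matrix (Fin (dim R (Γ := Γ) E)) (Fin (dim R (Γ := Γ) E)) (LaurentField R Γ)

variable {E}

/-- The matrix representation `ρ` is afforded by `E` with respect to some basis. -/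
def IsAfforded (ρ : MatrixRep R L E) : Prop :=
  ∃ b : Module.Basis (Fin (dim R (Γ := Γ) E)) (LaurentField R Γ) E,
    ∀ h, ρ h = LinearMap.toMatrix b b (action R L E h)

/-- Balanced matrix representations. -/
def IsBalanced [Fintype W] (ρ : MatrixRep R L E) : Prop :=
  ∀ w i j, eps R (aInvariant R L E) * ρ (T R L w) i j ∈ integers R Γ

/-- The leading matrix coefficient `c_w^{ij}`. -/
noncomputable def leadingCoeff [Fintype W] (ρ : MatrixRep R L E) (w : W)
    (i j : Fin (dim R (Γ := Γ) E)) : ScalarField R :=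
  constantTerm R ((-1) ^ cs.length w * eps R (aInvariant R L E) * ρ (T R L w) i j)

end Single

section Family

variable [Fintype W] {Λ : Type*} [Fintype Λ] {E : Λ → Type w} [∀ l, AddCommGroup (E l)]
  [∀ l, Module (LaurentField R Γ) (E l)] [∀ l, Module (HeckeK R L) (E l)]
  [∀ l, IsScalarTower (LaurentField R Γ) (HeckeK R L) (E l)]
  (ρ : ∀ l, MatrixRep R L (E l))

/-- The structure constant `γ̃_{x,y,z}`. -/
noncomputable def gammaTilde (x y z : W) : ScalarField R :=
  ∑ l, ∑ i, ∑ j, ∑ k, (fInvariant R L (E l))⁻¹ * leadingCoeff R L (ρ l) x i j *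
    leadingCoeff R L (ρ l) y j k * leadingCoeff R L (ρ l) z k i

/-- The coefficient `ñ_w`. -/
noncomputable def nTilde (w : W) : ScalarField R :=
  ∑ l, ∑ i, (fInvariant R L (E l))⁻¹ * leadingCoeff R L (ρ l) w⁻¹ i i

/-- A bilinear product and a distinguished element on the vector space with basis `W`. -/
structure BasedAlgebra (F W : Type*) [Field F] where
  mul : (W →₀ F) →ₗ[F] (W →₀ F) →ₗ[F] (W →₀ F)
  one : W →₀ F

open Classical in
/-- The ring `J̃` on the vector space over `F` with basis `t w = Finsupp.single w 1`: the product
is given by `t x * t y = ∑ z, γ̃_{x,y,z⁻¹} t z`, and the identity element is the sum of the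
`ñ_w t w` over the set `𝒟̃` of all `w` with `ñ_w ≠ 0`. -/
noncomputable def jTilde : BasedAlgebra (ScalarField R) W where
  mul := Finsupp.linearCombination _ fun x => Finsupp.linearCombination _ fun y =>
    ∑ z, gammaTilde R L ρ x y z⁻¹ • Finsupp.single z 1
  one := ∑ w with nTilde R L ρ w ≠ 0, nTilde R L ρ w • Finsupp.single w 1

end Family

end Representations

end LeadingCoefficients

/-!
The elements `x` of `K` of the form `a / (1 + b)` with `a` and `b` in `F[Γ_{>0}]` are exactly those
of `𝔭`; hence `𝔭` is a non-unital `F`-algebra, the constant term is the augmentation of its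
unitization `F ⊕ 𝔭`, and in particular it is multiplicative.  For a balanced representation `ρ` the
matrices `(-1) ^ l(w) ε ^ 𝒂 ρ(T w)` have entries in `F ⊕ 𝔭`, and taking constant terms turns them
into the matrices of leading coefficients.  The trace of a product of leading matrices is therefore
the constant term of the trace of an element of the Hecke algebra on the module, which does not
refer to a basis; both `γ̃` and `ñ` are combinations of such traces.
-/

namespace LeadingCoefficients

section FractionsOneAdd

/-- For a non-unital subalgebra `P`, the non-unital subalgebra of the fractions `a / (1 + b)` with
`a, b ∈ P`.  The denominator is cleared, so that no inverse is needed to define it. -/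
def fractionsOneAdd {F K : Type*} [CommSemiring F] [CommSemiring K] [Algebra F K]
    (P : NonUnitalSubalgebra F K) : NonUnitalSubalgebra F K where
  carrier := {x | ∃ b ∈ P, x * (1 + b) ∈ P}
  zero_mem' := ⟨0, zero_mem P, by rw [zero_mul]; exact zero_mem P⟩
  add_mem' := by
    rintro x y ⟨b, hb, hx⟩ ⟨d, hd, hy⟩
    refine ⟨b + d + b * d, add_mem (add_mem hb hd) (mul_mem hb hd), ?_⟩
    rw [show (x + y) * (1 + (b + d + b * d)) =
      x * (1 + b) + x * (1 + b) * d + (y * (1 + d) + y * (1 + d) * b) by ring]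
    exact add_mem (add_mem hx (mul_mem hx hd)) (add_mem hy (mul_mem hy hb))
  mul_mem' := by
    rintro x y ⟨b, hb, hx⟩ ⟨d, hd, hy⟩
    refine ⟨b + d + b * d, add_mem (add_mem hb hd) (mul_mem hb hd), ?_⟩
    rw [show x * y * (1 + (b + d + b * d)) = x * (1 + b) * (y * (1 + d)) by ring]
    exact mul_mem hx hy
  smul_mem' := by
    rintro r x ⟨b, hb, hx⟩
    exact ⟨b, hb, by rw [smul_mul_assoc]; exact SMulMemClass.smul_mem r hx⟩

variable {F K : Type*} [CommRing F]

section CommRing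

variable [CommRing K] [Algebra F K] {P : NonUnitalSubalgebra F K}

theorem one_add_ne_zero_of_mem (hP : (1 : K) ∉ P) {b : K} (hb : b ∈ P) : 1 + b ≠ 0 := fun h =>
  hP (by rw [eq_neg_of_add_eq_zero_left h]; exact neg_mem hb)

theorem one_notMem_fractionsOneAdd (hP : (1 : K) ∉ P) : (1 : K) ∉ fractionsOneAdd P := by
  rintro ⟨b, hb, h⟩
  rw [one_mul] at h
  exact hP ((add_mem_cancel_right hb).1 h)

end CommRing

theorem mem_fractionsOneAdd_iff [Field K] [Algebra F K] {P : NonUnitalSubalgebra F K}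
    (hP : (1 : K) ∉ P) {x : K} :
    x ∈ fractionsOneAdd P ↔ ∃ a ∈ P, ∃ b ∈ P, x = a / (1 + b) := by
  constructor
  · rintro ⟨b, hb, h⟩
    exact ⟨x * (1 + b), h, b, hb, (mul_div_cancel_right₀ x (one_add_ne_zero_of_mem hP hb)).symm⟩
  · rintro ⟨a, ha, b, hb, rfl⟩
    exact ⟨b, hb, by rwa [div_mul_cancel₀ a (one_add_ne_zero_of_mem hP hb)]⟩

end FractionsOneAdd

section ConstantTerm

variable (R : Subring ℂ) {Γ : Type*} [AddCommGroup Γ]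

theorem eps_zero : eps R (0 : Γ) = 1 :=
  map_one (algebraMap (LaurentRing R Γ) (LaurentField R Γ))

theorem eps_add (g h : Γ) : eps R (g + h) = eps R g * eps R h := by
  simp only [eps, ← map_mul, AddMonoidAlgebra.single_mul_single, one_mul]

variable [LinearOrder Γ] [IsOrderedAddMonoid Γ]

theorem linearIndependent_eps :
    LinearIndependent (ScalarField R) (eps R : Γ → LaurentField R Γ) := by
  have : IsScalarTower R (ScalarField R) (LaurentField R Γ) :=
    FractionRing.isScalarTower_liftAlgebra R (LaurentField R Γ)
  rw [← LinearIndependent.iff_fractionRing R (ScalarField R)]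
  have h_single :
      LinearIndependent R fun g : Γ => (AddMonoidAlgebra.single g 1 : LaurentRing R Γ) :=
    (Finsupp.linearIndependent_single_one R Γ).map'
      (AddMonoidAlgebra.coeffLinearEquiv R).symm.toLinearMap (LinearEquiv.ker _)
  exact h_single.map_injOn
    (IsScalarTower.toAlgHom R (LaurentRing R Γ) (LaurentField R Γ)).toLinearMap
    (IsFractionRing.injective _ _).injOn

variable {R}

theorem eps_mem_combinationsAbove {c g : Γ} (hg : c < g) : eps R g ∈ combinationsAbove R c :=
  Submodule.subset_span ⟨g, hg, rfl⟩

theorem eps_notMem_combinationsAbove (c : Γ) : eps R c ∉ combinationsAbove R c :=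
  (linearIndependent_eps R).notMem_span_image (lt_irrefl c)

theorem mul_mem_combinationsAbove {c d : Γ} {x y : LaurentField R Γ}
    (hx : x ∈ combinationsAbove R c) (hy : y ∈ combinationsAbove R d) :
    x * y ∈ combinationsAbove R (c + d) := by
  have h := Submodule.mul_mem_mul hx hy
  rw [combinationsAbove, combinationsAbove, Submodule.span_mul_span] at h
  refine Submodule.span_mono ?_ h
  rintro _ ⟨_, ⟨g, hg, rfl⟩, _, ⟨k, hk, rfl⟩, rfl⟩
  exact ⟨g + k, add_lt_add hg hk, eps_add R g k⟩

theorem eps_mul_mem_combinationsAbove (g : Γ) {c : Γ} {x : LaurentField R Γ}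
    (hx : x ∈ combinationsAbove R c) : eps R g * x ∈ combinationsAbove R (g + c) := by
  suffices combinationsAbove R c ≤
      (combinationsAbove R (g + c)).comap (LinearMap.mulLeft (ScalarField R) (eps R g)) from this hx
  refine Submodule.span_le.2 ?_
  rintro _ ⟨k, hk, rfl⟩
  change eps R g * eps R k ∈ combinationsAbove R (g + c)
  rw [← eps_add]
  exact eps_mem_combinationsAbove (add_lt_add_right hk g)

theorem exists_leadingTerm {c : Γ} {x : LaurentField R Γ} (hx : x ∈ combinationsAbove R c)
    (hx0 : x ≠ 0) : ∃ g, c < g ∧ ∃ r : ScalarField R, r ≠ 0 ∧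
      x - r • eps R g ∈ combinationsAbove R g := by
  obtain ⟨f, hf, rfl⟩ := (Finsupp.mem_span_image_iff_linearCombination _).1 hx
  have f_ne_zero : f ≠ 0 := by
    rintro rfl
    exact hx0 (map_zero _)
  have support_nonempty := Finsupp.support_nonempty_iff.2 f_ne_zero
  set g := f.support.min' support_nonempty
  have hg : g ∈ f.support := f.support.min'_mem _
  refine ⟨g, hf hg, f g, Finsupp.mem_support_iff.1 hg, ?_⟩
  rw [Finsupp.linearCombination_apply, Finsupp.sum, ← Finset.add_sum_erase _ _ hg,
    add_sub_cancel_left]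
  refine Submodule.sum_mem _ fun k hk => Submodule.smul_mem _ _ (eps_mem_combinationsAbove ?_)
  exact f.support.min'_lt_of_mem_erase_min' _ hk

theorem exists_hasExpansion_div {c : Γ} {a b : LaurentField R Γ} (ha : a ∈ combinationsAbove R c)
    (ha0 : a ≠ 0) (hb : b ∈ combinationsAbove R (0 : Γ)) :
    ∃ (r : ScalarField R) (g : Γ), c < g ∧ HasExpansion R (a / (1 + b)) r g := by
  obtain ⟨g, hg, r, hr, h⟩ := exists_leadingTerm ha ha0
  have hp := Submodule.smul_mem _ r⁻¹ (eps_mul_mem_combinationsAbove (-g) h)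
  rw [neg_add_cancel] at hp
  refine ⟨r, g, hg, _, hp, b, hb, ?_⟩
  have r_ne_zero : algebraMap _ (LaurentField R Γ) r ≠ 0 := by simpa using hr
  have eps_mul_eps_neg : eps R g * eps R (-g) = 1 := by rw [← eps_add, add_neg_cancel, eps_zero]
  rw [← mul_div_assoc, Algebra.smul_def, Algebra.smul_def, map_inv₀]
  congr 1
  field_simp
  linear_combination (algebraMap _ (LaurentField R Γ) r * eps R g - a) * eps_mul_eps_neg

variable (R Γ)

/-- `F[Γ_{>0}]` as a non-unital `F`-algebra. -/
noncomputable def positivePart : NonUnitalSubalgebra (ScalarField R) (LaurentField R Γ) where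
  __ := combinationsAbove R (0 : Γ)
  mul_mem' hx hy := by simpa using mul_mem_combinationsAbove hx hy

theorem one_notMem_positivePart : (1 : LaurentField R Γ) ∉ positivePart R Γ := by
  rw [← eps_zero]
  exact eps_notMem_combinationsAbove 0

/-- The maximal ideal `𝔭` as a non-unital `F`-algebra; see `mem_maximalIdeal_iff`. -/
noncomputable def valuationIdeal : NonUnitalSubalgebra (ScalarField R) (LaurentField R Γ) :=
  fractionsOneAdd (positivePart R Γ)

theorem one_notMem_valuationIdeal : (1 : LaurentField R Γ) ∉ valuationIdeal R Γ :=
  one_notMem_fractionsOneAdd (one_notMem_positivePart R Γ)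

theorem mem_valuationIdeal_iff {x : LaurentField R Γ} :
    x ∈ valuationIdeal R Γ ↔ ∃ a ∈ combinationsAbove R (0 : Γ),
      ∃ b ∈ combinationsAbove R (0 : Γ), x = a / (1 + b) :=
  mem_fractionsOneAdd_iff (one_notMem_positivePart R Γ)

theorem mem_maximalIdeal_iff {x : LaurentField R Γ} :
    x ∈ maximalIdeal R Γ ↔ x ∈ valuationIdeal R Γ := by
  rw [mem_valuationIdeal_iff]
  constructor
  · rintro (rfl | ⟨r, g, hg, p, hp, q, hq, rfl⟩)
    · exact ⟨0, zero_mem _, 0, zero_mem _, (zero_div _).symm⟩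
    · have eps_mem := eps_mem_combinationsAbove (R := R) hg
      have eps_mul_mem := mul_mem_combinationsAbove eps_mem hp
      rw [add_zero] at eps_mul_mem
      refine ⟨_, Submodule.smul_mem _ r (add_mem eps_mem eps_mul_mem), q, hq, ?_⟩
      rw [Algebra.smul_def]
      ring
  · rintro ⟨a, ha, b, hb, rfl⟩
    obtain rfl | ha0 := eq_or_ne a 0
    · exact Or.inl (zero_div _)
    · exact Or.inr (exists_hasExpansion_div ha ha0 hb)

/-- The valuation ring `𝒪 = F ⊕ 𝔭`. -/
noncomputable def valuationSubalgebra : Subalgebra (ScalarField R) (LaurentField R Γ) :=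
  Algebra.adjoin (ScalarField R) (valuationIdeal R Γ)

/-- The constant term as a homomorphism `𝒪 → F`: it is the augmentation of `𝒪`, seen as the
unitization of `𝔭`. -/
noncomputable def constantTermHom : valuationSubalgebra R Γ →ₐ[ScalarField R] ScalarField R :=
  (Unitization.fstHom (ScalarField R) (valuationIdeal R Γ)).comp
    (NonUnitalSubalgebra.unitizationAlgEquiv _ (one_notMem_valuationIdeal R Γ)).symm.toAlgHom

variable {R Γ}

theorem sub_constantTermHom_mem (x : valuationSubalgebra R Γ) :
    (x : LaurentField R Γ) - algebraMap _ _ (constantTermHom R Γ x) ∈ valuationIdeal R Γ := by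
  set e := NonUnitalSubalgebra.unitizationAlgEquiv _ (one_notMem_valuationIdeal R Γ)
  obtain ⟨u, rfl⟩ := e.surjective x
  have h : constantTermHom R Γ (e u) = u.fst :=
    congrArg (Unitization.fstHom _ _) (e.symm_apply_apply u)
  rw [h, NonUnitalSubalgebra.unitizationAlgEquiv_apply_coe, add_sub_cancel_left]
  exact u.snd.2

theorem eq_of_sub_mem_valuationIdeal {x : LaurentField R Γ} {r s : ScalarField R}
    (hr : x - algebraMap _ _ r ∈ valuationIdeal R Γ)
    (hs : x - algebraMap _ _ s ∈ valuationIdeal R Γ) : r = s := by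
  by_contra hrs
  refine one_notMem_valuationIdeal R Γ ?_
  have h := SMulMemClass.smul_mem (r - s)⁻¹ (sub_mem hs hr)
  rwa [sub_sub_sub_cancel_left, ← map_sub, Algebra.smul_def, ← map_mul,
    inv_mul_cancel₀ (sub_ne_zero.2 hrs), map_one] at h

theorem constantTermHom_apply (x : valuationSubalgebra R Γ) :
    constantTermHom R Γ x = constantTerm R (x : LaurentField R Γ) := by
  have h : ∃ r : ScalarField R, (x : LaurentField R Γ) - algebraMap _ _ r ∈ maximalIdeal R Γ :=
    ⟨_, (mem_maximalIdeal_iff R Γ).2 (sub_constantTermHom_mem x)⟩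
  rw [constantTerm, dif_pos h]
  exact eq_of_sub_mem_valuationIdeal (sub_constantTermHom_mem x)
    ((mem_maximalIdeal_iff R Γ).1 h.choose_spec)

theorem mem_valuationSubalgebra_of_sub_mem {x : LaurentField R Γ} (r : ScalarField R)
    (h : x - algebraMap _ _ r ∈ valuationIdeal R Γ) : x ∈ valuationSubalgebra R Γ := by
  rw [← sub_add_cancel x (algebraMap _ _ r)]
  exact add_mem (Algebra.subset_adjoin h) (algebraMap_mem _ r)

theorem integers_subset_valuationSubalgebra :
    integers R Γ ⊆ (valuationSubalgebra R Γ : Set (LaurentField R Γ)) := by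
  rintro x ⟨r, g, hg, hx⟩
  obtain rfl | hg := hg.eq_or_lt
  · obtain ⟨p, hp, q, hq, rfl⟩ := hx
    refine mem_valuationSubalgebra_of_sub_mem r ?_
    rw [mem_valuationIdeal_iff]
    refine ⟨_, Submodule.smul_mem _ r (sub_mem hp hq), q, hq, ?_⟩
    have one_add_ne_zero : 1 + q ≠ 0 := one_add_ne_zero_of_mem (one_notMem_positivePart R Γ) hq
    rw [eps_zero, Algebra.smul_def]
    field_simp
    ring
  · exact Algebra.subset_adjoin ((mem_maximalIdeal_iff R Γ).1 (Or.inr ⟨r, g, hg, hx⟩))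

end ConstantTerm

section LeadingMatrix

variable {B W : Type*} [Group W] {M : CoxeterMatrix B} {cs : CoxeterSystem M W}
  {R : Subring ℂ} {Γ : Type*} [AddCommGroup Γ] {L : cs.WeightFunction Γ}

section Single

variable {E : Type*} [AddCommGroup E] [Module (LaurentField R Γ) E]
  [Module (HeckeK R L) E] [IsScalarTower (LaurentField R Γ) (HeckeK R L) E]
  {ρ : MatrixRep R L E}

theorem IsAfforded.trace_eq (hρ : IsAfforded R L ρ) (h : HeckeK R L) :
    (ρ h).trace = LinearMap.trace _ _ (action R L E h) := by
  obtain ⟨b, hb⟩ := hρ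
  rw [hb, LinearMap.trace_eq_matrix_trace _ b]

variable [Fintype W] [LinearOrder Γ] [IsOrderedAddMonoid Γ]

variable (L E) in
/-- The element `(-1) ^ l(w) ε ^ 𝒂 T w`, on which balanced representations take values in
matrices over `𝒪`. -/
noncomputable def scaledT (w : W) : HeckeK R L :=
  ((-1) ^ cs.length w * eps R (aInvariant R L E)) • T R L w

variable (ρ) in
/-- The matrix of the leading coefficients `c_w^{ij}`. -/
noncomputable def leadingMatrix (w : W) :
    Matrix (Fin (dim R (Γ := Γ) E)) (Fin (dim R (Γ := Γ) E)) (ScalarField R) :=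
  Matrix.of (leadingCoeff R L ρ w)

theorem IsBalanced.scaledT_apply_mem (hρ : IsBalanced R L ρ) (w : W)
    (i j : Fin (dim R (Γ := Γ) E)) : ρ (scaledT L E w) i j ∈ valuationSubalgebra R Γ := by
  rw [scaledT, map_smul, Matrix.smul_apply, smul_eq_mul, mul_assoc]
  exact mul_mem (pow_mem (neg_mem (one_mem _)) _) (integers_subset_valuationSubalgebra (hρ w i j))

/-- The matrix over `𝒪` of a balanced representation at `(-1) ^ l(w) ε ^ 𝒂 T w`. -/
noncomputable def IsBalanced.integralMatrix (hρ : IsBalanced R L ρ) (w : W) :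
    Matrix (Fin (dim R (Γ := Γ) E)) (Fin (dim R (Γ := Γ) E)) (valuationSubalgebra R Γ) :=
  Matrix.of fun i j => ⟨ρ (scaledT L E w) i j, hρ.scaledT_apply_mem w i j⟩

theorem IsBalanced.mapMatrix_val_integralMatrix (hρ : IsBalanced R L ρ) (w : W) :
    (valuationSubalgebra R Γ).val.mapMatrix (hρ.integralMatrix w) = ρ (scaledT L E w) :=
  rfl

theorem IsBalanced.mapMatrix_constantTermHom_integralMatrix (hρ : IsBalanced R L ρ) (w : W) :
    (constantTermHom R Γ).mapMatrix (hρ.integralMatrix w) = leadingMatrix ρ w := by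
  ext i j
  change constantTermHom R Γ (hρ.integralMatrix w i j) = leadingCoeff R L ρ w i j
  rw [constantTermHom_apply]
  simp [integralMatrix, scaledT, leadingCoeff]

theorem trace_prod_leadingMatrix (hρ : IsAfforded R L ρ) (hρ' : IsBalanced R L ρ) (ws : List W) :
    (ws.map (leadingMatrix ρ)).prod.trace =
      constantTerm R (LinearMap.trace _ _ (action R L E (ws.map (scaledT L E)).prod)) := by
  set X := (ws.map hρ'.integralMatrix).prod
  have hX_const : (constantTermHom R Γ).mapMatrix X = (ws.map (leadingMatrix ρ)).prod := by
    rw [map_list_prod, List.map_map]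
    simp only [Function.comp_def, hρ'.mapMatrix_constantTermHom_integralMatrix]
  have hX_val : (valuationSubalgebra R Γ).val.mapMatrix X = ρ (ws.map (scaledT L E)).prod := by
    rw [map_list_prod, map_list_prod, List.map_map, List.map_map]
    simp only [Function.comp_def, hρ'.mapMatrix_val_integralMatrix]
  rw [← hρ.trace_eq, ← hX_val, ← hX_const]
  calc ((constantTermHom R Γ).mapMatrix X).trace
      = constantTermHom R Γ X.trace := (AddMonoidHom.map_trace _ X).symm
    _ = constantTerm R (X.trace : LaurentField R Γ) := constantTermHom_apply _
    _ = constantTerm R ((valuationSubalgebra R Γ).val.mapMatrix X).trace :=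
        congrArg _ (AddMonoidHom.map_trace (valuationSubalgebra R Γ).val X)

end Single

variable [Fintype W] [LinearOrder Γ] [IsOrderedAddMonoid Γ]
  {Λ : Type*} [Fintype Λ] {E : Λ → Type*} [∀ l, AddCommGroup (E l)]
  [∀ l, Module (LaurentField R Γ) (E l)] [∀ l, Module (HeckeK R L) (E l)]
  [∀ l, IsScalarTower (LaurentField R Γ) (HeckeK R L) (E l)]
  {ρ : ∀ l, MatrixRep R L (E l)}

theorem gammaTilde_eq_sum_trace (x y z : W) :
    gammaTilde R L ρ x y z =
      ∑ l, (fInvariant R L (E l))⁻¹ * ([x, y, z].map (leadingMatrix (ρ l))).prod.trace := by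
  simp only [gammaTilde, leadingMatrix, List.map_cons, List.map_nil, List.prod_cons, List.prod_nil,
    mul_one, Matrix.trace, Matrix.diag_apply, Matrix.mul_apply, Matrix.of_apply, Finset.mul_sum,
    mul_assoc]

theorem nTilde_eq_sum_trace (w : W) :
    nTilde R L ρ w =
      ∑ l, (fInvariant R L (E l))⁻¹ * ([w⁻¹].map (leadingMatrix (ρ l))).prod.trace := by
  simp only [nTilde, leadingMatrix, List.map_cons, List.map_nil, List.prod_cons, List.prod_nil,
    mul_one, Matrix.trace, Matrix.diag_apply, Matrix.of_apply, Finset.mul_sum]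

end LeadingMatrix

end LeadingCoefficients

open LeadingCoefficients in
theorem proposition3p7_general
    {B W : Type*} [Group W] [Fintype W] {M : CoxeterMatrix B} {cs : CoxeterSystem M W}
    {R : Subring ℂ} {Γ : Type*} [AddCommGroup Γ] [LinearOrder Γ] [IsOrderedAddMonoid Γ]
    {L : cs.WeightFunction Γ} {Λ : Type*} [Fintype Λ] {E : Λ → Type*} [∀ l, AddCommGroup (E l)]
    [∀ l, Module (LaurentField R Γ) (E l)] [∀ l, Module (HeckeK R L) (E l)]
    [∀ l, IsScalarTower (LaurentField R Γ) (HeckeK R L) (E l)]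
    {ρ σ : ∀ l, MatrixRep R L (E l)}
    (hρ : ∀ l, IsAfforded R L (ρ l)) (hσ : ∀ l, IsAfforded R L (σ l))
    (hρ' : ∀ l, IsBalanced R L (ρ l)) (hσ' : ∀ l, IsBalanced R L (σ l)) :
    (∀ x y z : W, gammaTilde R L ρ x y z = gammaTilde R L σ x y z) ∧
    (∀ w : W, nTilde R L ρ w = nTilde R L σ w) ∧ jTilde R L ρ = jTilde R L σ := by
  have trace_eq (l : Λ) (ws : List W) : (ws.map (leadingMatrix (ρ l))).prod.trace =
      (ws.map (leadingMatrix (σ l))).prod.trace := by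
    rw [trace_prod_leadingMatrix (hρ l) (hρ' l), trace_prod_leadingMatrix (hσ l) (hσ' l)]
  have gamma_eq (x y z : W) : gammaTilde R L ρ x y z = gammaTilde R L σ x y z := by
    simp only [gammaTilde_eq_sum_trace, trace_eq]
  have n_eq (w : W) : nTilde R L ρ w = nTilde R L σ w := by
    simp only [nTilde_eq_sum_trace, trace_eq]
  exact ⟨gamma_eq, n_eq, by simp only [jTilde, gamma_eq, n_eq]⟩

theorem proposition3p7
    {B W : Type*} [Group W] [Fintype W] {M : CoxeterMatrix B} {cs : CoxeterSystem M W}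
    (R : Subring ℂ)
    (hR : ∀ i j : B,
      ((2 * Real.cos (2 * Real.pi / orderOf (cs.simple i * cs.simple j)) : ℝ) : ℂ) ∈ R)
    {Γ : Type*} [AddCommGroup Γ] [LinearOrder Γ] [IsOrderedAddMonoid Γ]
    (L : cs.WeightFunction Γ) (hL : ∀ i : B, 0 < L (cs.simple i))
    {Λ : Type*} [Fintype Λ] (E : Λ → Type*) [∀ l, AddCommGroup (E l)]
    [∀ l, Module (LeadingCoefficients.LaurentField R Γ) (E l)]
    [∀ l, Module (LeadingCoefficients.HeckeK R L) (E l)]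
    [∀ l, IsScalarTower (LeadingCoefficients.LaurentField R Γ)
      (LeadingCoefficients.HeckeK R L) (E l)]
    (hE : LeadingCoefficients.IsIrr R L E)
    (ρ σ : ∀ l, LeadingCoefficients.MatrixRep R L (E l))
    (hρ : ∀ l, LeadingCoefficients.IsAfforded R L (ρ l))
    (hσ : ∀ l, LeadingCoefficients.IsAfforded R L (σ l))
    (hρ' : ∀ l, LeadingCoefficients.IsBalanced R L (ρ l))
    (hσ' : ∀ l, LeadingCoefficients.IsBalanced R L (σ l)) :
    (∀ x y z : W, LeadingCoefficients.gammaTilde R L ρ x y z =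
      LeadingCoefficients.gammaTilde R L σ x y z) ∧
    (∀ w : W, LeadingCoefficients.nTilde R L ρ w = LeadingCoefficients.nTilde R L σ w) ∧
    LeadingCoefficients.jTilde R L ρ = LeadingCoefficients.jTilde R L σ :=
  proposition3p7_general hρ hσ hρ' hσ'
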